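/- Let $\Gamma=(X,R)$ be a distance-regular graph: a finite, undirected, connected graph without loops or multiple edges, with path-length distance $\partial$, such that for all $h,i,j$ the number $p^h_{ij}=|\{z\in X:\partial(x,z)=i,\ \partial(y,z)=j\}|$ is the same for all $x,y\in X$ with $\partial(x,y)=h$. Let $d=\max\{\partial(x,y): x,y\in X\}$ be its diameter and assume $d\ge 3$ and $a_1:=p^1_{11}\neq 0$. Let $A$ be the adjacency matrix of $\Gamma$, $k=p^0_{11}$ its valency, and let the Bose–Mesner algebra $M$ be the subalgebra (with identity) of $\mathrm{Mat}_X(\mathbb R)$ generated by $A$. The eigenvalues of $\Gamma$ are the real numbers $\theta$ with $AE=\theta E$ for a primitive idempotent $E$ of $M$ (a nonzero idempotent $E\in M$ such that the only idempotents $F\in M$ with $FE=EF=F$ are $0$ and $E$); $E$ is then determined by $\theta$ and is called the primitive idempotent associated with $\theta$. An eigenvalue is nontrivial if it is different from $k$. For $x\in X$ let $\hat x\in\mathbb R^X$ be the vector with $1$ in coordinate $x$ and $0$ in all other coordinates, and for an edge $xy\in R$ let $D_1^1=D_1^1(x,y)=\{z\in X:\partial(x,z)=\partial(y,z)=1\}$.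 The edge $xy$ is tight with respect to a nontrivial eigenvalue $\theta$, with associated primitive idempotent $E$, if the three vectors $E\hat x$, $E\hat y$, $\sum_{z\in D_1^1}E\hat z$ are linearly dependent. The tightness $t(x,y)$ is the number of nontrivial eigenvalues of $\Gamma$ with respect to which $xy$ is tight. Then for every edge $xy\in R$, $$t(x,y)=3d+1-\dim(MH),$$ where $H=\mathrm{Span}\{\hat x,\ \hat y,\ \sum_{z\in D_1^1}\hat z\}$ and $MH=\mathrm{Span}\{mh : m\in M,\ h\in H\}$. -/

import Mathlib

namespace DRG

/-- The set `D_i^j(x, y)` of the vertices `z` with `∂(x, z) = i` and `∂(y, z) = j`. -/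
noncomputable def D {V : Type*} [Fintype V] (G : SimpleGraph V) (i j : ℕ) (x y : V) : Finset V :=
  Finset.univ.filter (fun z => G.dist x z = i ∧ G.dist y z = j)

/-- A finite graph is distance-regular if it is connected and, for all `h, i, j`, the number
`|Γ_i(x) ∩ Γ_j(y)|` is the same for all vertices `x, y` at distance `h`. -/
structure IsDistanceRegular {V : Type*} [Fintype V] (G : SimpleGraph V) : Prop where
  connected : G.Connected
  card_eq : ∀ (h i j : ℕ) (x y x' y' : V), G.dist x y = h → G.dist x' y' = h →
    (D G i j x y).card = (D G i j x' y').card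

/-- The intersection number `p^h_{ij}` of a graph, written as the maximum of
`|Γ_i(x) ∩ Γ_j(y)|` over the pairs `x, y` at distance `h`; in a distance-regular graph all these
numbers agree (see `card_D_eq_intersectionNumber`). -/
noncomputable def intersectionNumber {V : Type*} [Fintype V] (G : SimpleGraph V)
    (h i j : ℕ) : ℕ :=
  ((Finset.univ : Finset (V × V)).filter (fun q => G.dist q.1 q.2 = h)).sup
    (fun q => (D G i j q.1 q.2).card)

theorem card_D_eq_intersectionNumber {V : Type*} [Fintype V] {G : SimpleGraph V}
    (hG : IsDistanceRegular G) (i j : ℕ) (x y : V) :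
    (D G i j x y).card = intersectionNumber G (G.dist x y) i j := by
  unfold intersectionNumber
  apply le_antisymm
  · exact Finset.le_sup (f := fun q : V × V => (D G i j q.1 q.2).card) (b := (x, y)) (by simp)
  · refine Finset.sup_le fun q hq => ?_
    exact (hG.card_eq _ i j q.1 q.2 x y (Finset.mem_filter.mp hq).2 rfl).le

/-- The intersection number `a_i = p^i_{1 i}`. -/
noncomputable def a {V : Type*} [Fintype V] (G : SimpleGraph V) (i : ℕ) : ℕ :=
  intersectionNumber G i 1 i

/-- The valency `k = p^0_{1 1}`. -/
noncomputable def valency {V : Type*} [Fintype V] (G : SimpleGraph V) : ℕ :=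
  intersectionNumber G 0 1 1

/-- The Bose-Mesner algebra: the (unital) algebra of real matrices generated by the adjacency
matrix. -/
noncomputable def boseMesner {V : Type*} [Fintype V] [DecidableEq V] (G : SimpleGraph V)
    [DecidableRel G.Adj] : Subalgebra ℝ (Matrix V V ℝ) :=
  Algebra.adjoin ℝ {G.adjMatrix ℝ}

/-- The primitive idempotents of the graph: the nonzero idempotents `E` of the Bose-Mesner algebra
that are minimal, i.e. an idempotent `F` of the algebra with `F E = E F = F` is `0` or `E`. -/
structure IsPrimitiveIdempotent {V : Type*} [Fintype V] [DecidableEq V] (G : SimpleGraph V)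
    [DecidableRel G.Adj] (E : Matrix V V ℝ) : Prop where
  mem : E ∈ boseMesner G
  ne_zero : E ≠ 0
  idem : E * E = E
  minimal : ∀ F ∈ boseMesner G, F * F = F → F * E = F → E * F = F → F = 0 ∨ F = E

/-- `θ` is the eigenvalue of the graph associated with the primitive idempotent `E`. -/
def IsAssociated {V : Type*} [Fintype V] [DecidableEq V] (G : SimpleGraph V)
    [DecidableRel G.Adj] (θ : ℝ) (E : Matrix V V ℝ) : Prop :=
  IsPrimitiveIdempotent G E ∧ G.adjMatrix ℝ * E = θ • E

/-- A nontrivial eigenvalue of the graph: an eigenvalue `θ` (associated with some primitive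
idempotent) other than the valency `k`. -/
def IsNontrivialEigenvalue {V : Type*} [Fintype V] [DecidableEq V] (G : SimpleGraph V)
    [DecidableRel G.Adj] (θ : ℝ) : Prop :=
  (∃ E, IsAssociated G θ E) ∧ θ ≠ (valency G : ℝ)

/-- The characteristic vector `x̂` of the vertex `x`. -/
def hat {V : Type*} [DecidableEq V] (x : V) : V → ℝ := Pi.single x 1

/-- The vector `∑ ẑ`, the sum over the `z ∈ D_1^1(x, y)`. -/
noncomputable def w {V : Type*} [Fintype V] [DecidableEq V] (G : SimpleGraph V) (x y : V) :
    V → ℝ :=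
  ∑ z ∈ D G 1 1 x y, hat z

open scoped Matrix in
/-- `xy` is tight with respect to `θ`: the vectors `E x̂`, `E ŷ`, `E ∑ ẑ` are linearly dependent,
where `E` is the primitive idempotent associated with `θ`. -/
def IsTightWrt {V : Type*} [Fintype V] [DecidableEq V] (G : SimpleGraph V)
    [DecidableRel G.Adj] (x y : V) (θ : ℝ) : Prop :=
  ∃ E, IsAssociated G θ E ∧ ¬ LinearIndependent ℝ ![E *ᵥ hat x, E *ᵥ hat y, E *ᵥ w G x y]

/-- The tightness `t(x, y)`: the number of nontrivial eigenvalues with respect to which `xy` is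
tight. -/
noncomputable def tightness {V : Type*} [Fintype V] [DecidableEq V] (G : SimpleGraph V)
    [DecidableRel G.Adj] (x y : V) : ℕ :=
  Set.ncard {θ : ℝ | IsNontrivialEigenvalue G θ ∧ IsTightWrt G x y θ}

/-- The subspace `H = Span {x̂, ŷ, ∑ ẑ}`. -/
noncomputable def H {V : Type*} [Fintype V] [DecidableEq V] (G : SimpleGraph V) (x y : V) :
    Submodule ℝ (V → ℝ) :=
  Submodule.span ℝ {hat x, hat y, w G x y}

open scoped Matrix in
/-- The subspace `M W = Span {m h | m ∈ M, h ∈ W}`, with `M` the Bose-Mesner algebra. -/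
noncomputable def boseMesnerSpan {V : Type*} [Fintype V] [DecidableEq V] (G : SimpleGraph V)
    [DecidableRel G.Adj] (W : Submodule ℝ (V → ℝ)) : Submodule ℝ (V → ℝ) :=
  Submodule.span ℝ {v | ∃ m ∈ boseMesner G, ∃ h ∈ W, v = m *ᵥ h}

end DRG

/-! Write `E_θ` for the primitive idempotents. They are orthogonal, sum to `1` and span `M`, so `MH`
is the direct sum of the spaces `E_θ H` (`finrank_span_adjoin_mulVec`), and its dimension is a sum
over the `d + 1` eigenvalues (`card_spec`). For `θ = k` the image of `E_θ` consists of constant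
vectors, so the summand has dimension `1`. For any other `θ`, `E_θ x̂` and `E_θ ŷ` are independent
(`linearIndependent_idem_hat`): dependence would force `θ = ±k`, and `-k` is excluded because `a_1 ≠
0` puts the edge in a triangle. Hence `E_θ H` has dimension `2` if the edge is tight with respect to
`θ` and `3` otherwise, and `dim MH = 1 + 3d - t`. -/

open Polynomial

/-! ### Spectral projections of a real symmetric matrix -/

namespace Matrix.IsHermitian

variable {V : Type*} [Fintype V] [DecidableEq V] {A : Matrix V V ℝ} (hA : A.IsHermitian)

/-- The finite set of the eigenvalues of a real symmetric matrix. -/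
noncomputable def eigenvalueFinset : Finset ℝ := Finset.univ.image hA.eigenvalues

/-- The orthogonal projection onto the eigenspace of `θ`, as a polynomial in the matrix. -/
noncomputable def eigenprojection (θ : ℝ) : Matrix V V ℝ :=
  aeval A (Lagrange.basis hA.eigenvalueFinset id θ)

include hA in
theorem aeval_eq_conj (p : ℝ[X]) :
    aeval A p = Unitary.conjStarAlgAut ℝ _ hA.eigenvectorUnitary
      (diagonal fun i => p.eval (hA.eigenvalues i)) := by
  conv_lhs => rw [hA.spectral_theorem]
  rw [aeval_algHom_apply]
  congr 1
  have h : (diagonal (RCLike.ofReal ∘ hA.eigenvalues) : Matrix V V ℝ) =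
      diagonalAlgHom ℝ hA.eigenvalues := rfl
  rw [h, aeval_algHom_apply]
  change diagonal _ = _
  congr 1
  ext i
  rw [aeval_pi_apply₂]
  simp [aeval_def, eval₂_eq_eval_map]

/-- Diagonalization reduces identities between polynomials in `A` to pointwise checks on the
spectrum, where the projections become indicator functions. -/
theorem aeval_eq_zero_iff (p : ℝ[X]) :
    aeval A p = 0 ↔ ∀ s ∈ hA.eigenvalueFinset, p.eval s = 0 := by
  rw [hA.aeval_eq_conj, EmbeddingLike.map_eq_zero_iff, diagonal_eq_zero]
  simp [eigenvalueFinset, funext_iff]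

theorem aeval_eq_aeval_iff (p q : ℝ[X]) :
    aeval A p = aeval A q ↔ ∀ s ∈ hA.eigenvalueFinset, p.eval s = q.eval s := by
  rw [← sub_eq_zero, ← map_sub, hA.aeval_eq_zero_iff]
  simp [sub_eq_zero]

theorem eval_basis {θ s : ℝ} (hθ : θ ∈ hA.eigenvalueFinset) (hs : s ∈ hA.eigenvalueFinset) :
    (Lagrange.basis hA.eigenvalueFinset id θ).eval s = if s = θ then 1 else 0 := by
  split_ifs with h
  · subst h
    exact Lagrange.eval_basis_self (v := id) (Set.injOn_id _) hs
  · exact Lagrange.eval_basis_of_ne (v := id) (Ne.symm h) hs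

theorem eigenprojection_mul_self {θ : ℝ} (hθ : θ ∈ hA.eigenvalueFinset) :
    hA.eigenprojection θ * hA.eigenprojection θ = hA.eigenprojection θ := by
  rw [eigenprojection, ← map_mul, hA.aeval_eq_aeval_iff]
  intro s hs
  simp [hA.eval_basis hθ hs]

theorem eigenprojection_mul_of_ne {θ η : ℝ} (hθ : θ ∈ hA.eigenvalueFinset)
    (hη : η ∈ hA.eigenvalueFinset) (h : θ ≠ η) :
    hA.eigenprojection θ * hA.eigenprojection η = 0 := by
  rw [eigenprojection, eigenprojection, ← map_mul, hA.aeval_eq_zero_iff]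
  intro s hs
  simp only [eval_mul, hA.eval_basis hθ hs, hA.eval_basis hη hs]
  grind

theorem mul_eigenprojection {θ : ℝ} (hθ : θ ∈ hA.eigenvalueFinset) :
    A * hA.eigenprojection θ = θ • hA.eigenprojection θ := by
  have h : aeval A (X * Lagrange.basis hA.eigenvalueFinset id θ) =
      aeval A (θ • Lagrange.basis hA.eigenvalueFinset id θ) := by
    rw [hA.aeval_eq_aeval_iff]
    intro s hs
    simp only [eval_mul, eval_X, eval_smul, hA.eval_basis hθ hs]
    split_ifs with h <;> simp [h]
  simpa [eigenprojection] using h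

theorem sum_eigenprojection : ∑ θ ∈ hA.eigenvalueFinset, hA.eigenprojection θ = 1 := by
  simp only [eigenprojection]
  rw [← map_sum, ← map_one (aeval A : ℝ[X] →ₐ[ℝ] Matrix V V ℝ), hA.aeval_eq_aeval_iff]
  intro s hs
  rw [eval_finsetSum, Finset.sum_congr rfl fun θ hθ => hA.eval_basis hθ hs]
  simp [hs]

theorem eigenprojection_ne_zero {θ : ℝ} (hθ : θ ∈ hA.eigenvalueFinset) :
    hA.eigenprojection θ ≠ 0 := by
  rw [eigenprojection, Ne, hA.aeval_eq_zero_iff]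
  intro h
  simpa [hA.eval_basis hθ hθ] using h θ hθ

theorem eigenprojection_mem (θ : ℝ) : hA.eigenprojection θ ∈ Algebra.adjoin ℝ {A} :=
  aeval_mem_adjoin_singleton ℝ A

theorem mul_eigenprojection_of_mem {B : Matrix V V ℝ} (hB : B ∈ Algebra.adjoin ℝ {A})
    {θ : ℝ} (hθ : θ ∈ hA.eigenvalueFinset) :
    ∃ c : ℝ, hA.eigenprojection θ * B = c • hA.eigenprojection θ := by
  rw [Algebra.adjoin_singleton_eq_range_aeval] at hB
  obtain ⟨p, rfl⟩ := hB
  refine ⟨p.eval θ, ?_⟩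
  simp only [eigenprojection]
  change _ * aeval A p = _
  rw [← map_mul, ← map_smul, hA.aeval_eq_aeval_iff]
  intro s hs
  simp only [eval_mul, eval_smul, hA.eval_basis hθ hs]
  split_ifs with h <;> simp [h]

theorem linearIndependent_eigenprojection :
    LinearIndependent ℝ fun θ : hA.eigenvalueFinset => hA.eigenprojection θ := by
  rw [Fintype.linearIndependent_iff]
  intro g hg θ
  have h := congrArg (hA.eigenprojection θ * ·) hg
  simp only [Finset.mul_sum, mul_zero, Matrix.mul_smul] at h
  rw [Finset.sum_eq_single θ, hA.eigenprojection_mul_self θ.2] at h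
  · exact (smul_eq_zero.mp h).resolve_right (hA.eigenprojection_ne_zero θ.2)
  · intro η _ hη
    rw [hA.eigenprojection_mul_of_ne θ.2 η.2 (fun h => hη (Subtype.ext h.symm)), smul_zero]
  · simp

/-- Write `B = p(A)`. On the spectrum `p` vanishes away from `θ` by the eigenvalue equation, and its
nonzero values are `1` by idempotence, so it agrees with the Lagrange basis polynomial at `θ`. -/
theorem eigenprojection_eq_of_mem {B : Matrix V V ℝ} (hB : B ∈ Algebra.adjoin ℝ {A})
    (hB0 : B ≠ 0) (hB2 : B * B = B) {θ : ℝ} (h : A * B = θ • B) :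
    θ ∈ hA.eigenvalueFinset ∧ B = hA.eigenprojection θ := by
  rw [Algebra.adjoin_singleton_eq_range_aeval] at hB
  obtain ⟨p, rfl⟩ := hB
  change aeval A p ≠ 0 at hB0
  change aeval A p * aeval A p = aeval A p at hB2
  change A * aeval A p = θ • aeval A p at h
  change _ ∧ aeval A p = _
  have h' : aeval A (X * p) = aeval A (θ • p) := by simpa using h
  rw [← map_mul, hA.aeval_eq_aeval_iff] at hB2
  rw [hA.aeval_eq_aeval_iff] at h'
  rw [Ne, hA.aeval_eq_zero_iff] at hB0
  push Not at hB0
  have key : ∀ s ∈ hA.eigenvalueFinset, p.eval s ≠ 0 → s = θ ∧ p.eval s = 1 := by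
    intro s hs h0
    have h1 := h' s hs
    have h2 := hB2 s hs
    simp only [eval_mul, eval_X, eval_smul, smul_eq_mul] at h1 h2
    exact ⟨mul_right_cancel₀ h0 h1, mul_right_cancel₀ h0 (by rw [h2, one_mul])⟩
  obtain ⟨s, hs, h0⟩ := hB0
  have hsθ := key s hs h0
  rw [hsθ.1] at hs hsθ
  refine ⟨hs, ?_⟩
  rw [eigenprojection, hA.aeval_eq_aeval_iff]
  intro t ht
  rw [hA.eval_basis hs ht]
  split_ifs with htθ
  · rw [htθ]; exact hsθ.2
  · by_contra h1
    exact htθ (key t ht h1).1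

theorem eigenprojection_minimal {θ : ℝ} (hθ : θ ∈ hA.eigenvalueFinset) {F : Matrix V V ℝ}
    (hF : F ∈ Algebra.adjoin ℝ {A}) (hF2 : F * F = F) (h : hA.eigenprojection θ * F = F) :
    F = 0 ∨ F = hA.eigenprojection θ := by
  by_cases h0 : F = 0
  · exact Or.inl h0
  · refine Or.inr (hA.eigenprojection_eq_of_mem hF h0 hF2 ?_).2
    rw [← h, ← mul_assoc, hA.mul_eigenprojection hθ, smul_mul_assoc]

theorem mem_eigenvalueFinset_of_mulVec {θ : ℝ} {v : V → ℝ} (hv : v ≠ 0) (h : A *ᵥ v = θ • v) :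
    θ ∈ hA.eigenvalueFinset := by
  by_contra hθ
  refine hv ?_
  rw [← one_mulVec v, ← hA.sum_eigenprojection, sum_mulVec]
  refine Finset.sum_eq_zero fun η hη => ?_
  have hcomm : hA.eigenprojection η * A = A * hA.eigenprojection η := by
    have : ∀ p q : ℝ[X], aeval A p * aeval A q = aeval A q * aeval A p := fun p q => by
      rw [← map_mul, mul_comm, map_mul]
    simpa [eigenprojection] using this _ X
  have h1 : θ • hA.eigenprojection η *ᵥ v = η • hA.eigenprojection η *ᵥ v := by
    rw [← mulVec_smul, ← h, mulVec_mulVec, hcomm, hA.mul_eigenprojection hη, smul_mulVec]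
  rw [← sub_eq_zero, ← sub_smul] at h1
  refine (smul_eq_zero.mp h1).resolve_left fun h2 => hθ ?_
  rwa [sub_eq_zero.mp h2]

end Matrix.IsHermitian

/-! ### Spectral decomposition of the span of `m h` -/

namespace Matrix.IsHermitian

variable {V : Type*} [Fintype V] [DecidableEq V] {A : Matrix V V ℝ} (hA : A.IsHermitian)

/-- The map `u ↦ (E_θ u)_θ` is an isomorphism onto the product of the `E_θ W`: injective since the
projections sum to `1`, surjective since they are orthogonal idempotents in the algebra. -/
theorem finrank_span_adjoin_mulVec (W : Submodule ℝ (V → ℝ)) :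
    Module.finrank ℝ (Submodule.span ℝ
      {v | ∃ m ∈ Algebra.adjoin ℝ {A}, ∃ h ∈ W, v = m *ᵥ h}) =
      ∑ θ ∈ hA.eigenvalueFinset, Module.finrank ℝ (W.map (hA.eigenprojection θ).mulVecLin) := by
  set U := Submodule.span ℝ {v | ∃ m ∈ Algebra.adjoin ℝ {A}, ∃ h ∈ W, v = m *ᵥ h} with hU
  -- For `m` in the algebra, `E_θ m` is a multiple of `E_θ`, so `E_θ` sends the span into `E_θ W`.
  have hmem : ∀ θ : hA.eigenvalueFinset, ∀ u : U,
      (hA.eigenprojection θ).mulVecLin u ∈ W.map (hA.eigenprojection θ).mulVecLin := by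
    rintro θ ⟨u, hu⟩
    induction hu using Submodule.span_induction with
    | mem v hv =>
      obtain ⟨m, hm, h, hh, rfl⟩ := hv
      obtain ⟨c, hc⟩ := hA.mul_eigenprojection_of_mem hm θ.2
      refine ⟨c • h, W.smul_mem _ hh, ?_⟩
      simp [hc, smul_mulVec]
    | zero => simp
    | add v w _ _ hv hw => simpa [mulVec_add] using Submodule.add_mem _ hv hw
    | smul c v _ hv => simpa [mulVec_smul] using Submodule.smul_mem _ c hv
  let Φ : U →ₗ[ℝ] (Π θ : hA.eigenvalueFinset, W.map (hA.eigenprojection θ).mulVecLin) :=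
    LinearMap.pi fun θ => LinearMap.codRestrict _
      ((hA.eigenprojection θ).mulVecLin ∘ₗ U.subtype) (hmem θ)
  have hinj : Function.Injective Φ := by
    rw [← LinearMap.ker_eq_bot, LinearMap.ker_eq_bot']
    rintro ⟨u, hu⟩ h
    refine Subtype.ext ?_
    change u = 0
    rw [← one_mulVec u, ← hA.sum_eigenprojection, sum_mulVec]
    refine Finset.sum_eq_zero fun θ hθ => ?_
    exact congrArg Subtype.val (congrFun h ⟨θ, hθ⟩)
  have hsurj : Function.Surjective Φ := by
    intro f
    choose g hgW hg using fun θ => (f θ).2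
    refine ⟨⟨∑ θ, (f θ : V → ℝ), Submodule.sum_mem _ fun θ _ => Submodule.subset_span
      ⟨_, hA.eigenprojection_mem θ, g θ, hgW θ, (hg θ).symm⟩⟩, ?_⟩
    ext1 θ
    refine Subtype.ext ?_
    change hA.eigenprojection θ *ᵥ ∑ η, (f η : V → ℝ) = f θ
    rw [mulVec_sum, Finset.sum_eq_single θ]
    · rw [← hg θ, mulVecLin_apply, mulVec_mulVec, hA.eigenprojection_mul_self θ.2]
    · intro η _ hη
      rw [← hg η, mulVecLin_apply, mulVec_mulVec,
        hA.eigenprojection_mul_of_ne θ.2 η.2 (fun h => hη (Subtype.ext h.symm)), zero_mulVec]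
    · simp
  rw [(LinearEquiv.ofBijective Φ ⟨hinj, hsurj⟩).finrank_eq, Module.finrank_pi_fintype,
    ← Finset.sum_coe_sort hA.eigenvalueFinset
      fun θ => Module.finrank ℝ (W.map (hA.eigenprojection θ).mulVecLin)]

end Matrix.IsHermitian

/-- In the span of three vectors of which the first two are independent, the dimension detects
the dependence of the triple. -/
theorem finrank_span_triple {K E : Type*} [Field K] [AddCommGroup E] [Module K E] {u v w : E}
    (h : LinearIndependent K ![u, v]) [Decidable (LinearIndependent K ![u, v, w])] :
    Module.finrank K (Submodule.span K {u, v, w}) =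
      if LinearIndependent K ![u, v, w] then 3 else 2 := by
  have hr : Set.range ![u, v, w] = {u, v, w} := by
    simp only [Matrix.range_cons, Matrix.range_empty, Set.union_empty, Set.singleton_union]
  have hr2 : Set.range ![u, v] = {u, v} := by
    simp only [Matrix.range_cons, Matrix.range_empty, Set.union_empty, Set.singleton_union]
  split_ifs with h3
  · rw [← hr, finrank_span_eq_card h3, Fintype.card_fin]
  · have hw : w ∈ Submodule.span K {u, v} := by
      by_contra hw
      refine h3 ?_
      have := linearIndependent_finSnoc.mpr ⟨h, by rwa [hr2]⟩
      convert this using 1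
      ext i
      fin_cases i <;> rfl
    have : Submodule.span K {u, v, w} = Submodule.span K (Set.range ![u, v]) := by
      rw [hr2]
      refine le_antisymm (Submodule.span_le.mpr ?_) (Submodule.span_mono ?_)
      · rintro z (rfl | rfl | rfl)
        · exact Submodule.subset_span (by simp)
        · exact Submodule.subset_span (by simp)
        · exact hw
      · grind
    rw [this, finrank_span_eq_card h, Fintype.card_fin]

open Matrix

/-! ### Distance-regular graphs and their spectrum -/

namespace DRG

variable {V : Type*} [Fintype V] {G : SimpleGraph V}

theorem IsDistanceRegular.dist_le_diam (hG : IsDistanceRegular G) (u v : V) :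
    G.dist u v ≤ G.diam := by
  have := hG.connected.nonempty
  exact SimpleGraph.dist_le_diam (SimpleGraph.connected_iff_ediam_ne_top.mp hG.connected)

theorem IsDistanceRegular.degree_eq [DecidableRel G.Adj] (hG : IsDistanceRegular G) (v : V) :
    G.degree v = valency G := by
  have h := card_D_eq_intersectionNumber hG 1 1 v v
  rw [SimpleGraph.dist_self] at h
  rw [valency, ← h, ← SimpleGraph.card_neighborFinset_eq_degree]
  congr 1
  ext z
  simp [D, SimpleGraph.dist_eq_one_iff_adj]

/-- Grouping the `z` by their pair of distances makes the sum a function of `∂(u, v)` alone; hence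
products of distance-dependent matrices are distance-dependent. -/
theorem sum_dist_mul_dist (hG : IsDistanceRegular G) (f g : ℕ → ℝ) (u v : V) :
    ∑ z, f (G.dist u z) * g (G.dist v z) =
      ∑ ij ∈ Finset.range (G.diam + 1) ×ˢ Finset.range (G.diam + 1),
        (intersectionNumber G (G.dist u v) ij.1 ij.2 : ℝ) * (f ij.1 * g ij.2) := by
  rw [← Finset.sum_fiberwise_of_maps_to (g := fun z => (G.dist u z, G.dist v z))
    (t := Finset.range (G.diam + 1) ×ˢ Finset.range (G.diam + 1))]
  · refine Finset.sum_congr rfl fun ij _ => ?_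
    rw [← card_D_eq_intersectionNumber hG, ← nsmul_eq_mul]
    have : (Finset.univ.filter fun z => (G.dist u z, G.dist v z) = ij) = D G ij.1 ij.2 u v := by
      ext z
      simp [D, Prod.ext_iff]
    rw [this]
    refine Finset.sum_eq_card_nsmul fun z hz => ?_
    simp only [D, Finset.mem_filter] at hz
    rw [hz.2.1, hz.2.2]
  · intro z _
    simpa [Nat.lt_succ_iff] using ⟨hG.dist_le_diam u z, hG.dist_le_diam v z⟩

theorem exists_common_neighbor (hG : IsDistanceRegular G) (ha : a G 1 ≠ 0) {x y : V}
    (hxy : G.Adj x y) : ∃ z, G.Adj x z ∧ G.Adj y z := by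
  rw [a, ← SimpleGraph.dist_eq_one_iff_adj.mpr hxy, ← card_D_eq_intersectionNumber hG,
    SimpleGraph.dist_eq_one_iff_adj.mpr hxy] at ha
  obtain ⟨z, hz⟩ := Finset.card_ne_zero.mp ha
  simp only [D, Finset.mem_filter, SimpleGraph.dist_eq_one_iff_adj] at hz
  exact ⟨z, hz.2⟩

variable [DecidableEq V]

theorem mulVec_hat (E : Matrix V V ℝ) (u v : V) : (E *ᵥ hat v) u = E u v := by
  simp [hat]

theorem map_H (E : Matrix V V ℝ) (x y : V) :
    (H G x y).map E.mulVecLin =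
      Submodule.span ℝ {E *ᵥ hat x, E *ᵥ hat y, E *ᵥ w G x y} := by
  rw [H, Submodule.map_span, Set.image_insert_eq, Set.image_insert_eq, Set.image_singleton]
  rfl

variable [DecidableRel G.Adj]

/-- The entries of a matrix in the Bose-Mesner algebra depend only on the distance. -/
theorem exists_eq_of_mem_boseMesner (hG : IsDistanceRegular G) {B : Matrix V V ℝ}
    (hB : B ∈ boseMesner G) : ∃ f : ℕ → ℝ, ∀ u v, B u v = f (G.dist u v) := by
  induction hB using Algebra.adjoin_induction with
  | mem B hB =>
    rw [Set.mem_singleton_iff] at hB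
    subst hB
    refine ⟨fun n => if n = 1 then 1 else 0, fun u v => ?_⟩
    simp [SimpleGraph.adjMatrix_apply, SimpleGraph.dist_eq_one_iff_adj]
  | algebraMap r =>
    refine ⟨fun n => if n = 0 then r else 0, fun u v => ?_⟩
    simp [Matrix.algebraMap_matrix_apply, hG.connected.dist_eq_zero_iff]
  | add B C _ _ hB hC =>
    obtain ⟨f, hf⟩ := hB
    obtain ⟨g, hg⟩ := hC
    exact ⟨fun n => f n + g n, fun u v => by simp [hf, hg]⟩
  | mul B C _ _ hB hC =>
    obtain ⟨f, hf⟩ := hB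
    obtain ⟨g, hg⟩ := hC
    refine ⟨fun n => ∑ ij ∈ Finset.range (G.diam + 1) ×ˢ Finset.range (G.diam + 1),
        (intersectionNumber G n ij.1 ij.2 : ℝ) * (f ij.1 * g ij.2), fun u v => ?_⟩
    rw [Matrix.mul_apply]
    refine Eq.trans ?_ (sum_dist_mul_dist hG f g u v)
    exact Finset.sum_congr rfl fun z _ => by rw [hf, hg, G.dist_comm (u := z)]

/-- The eigenvalues of the adjacency matrix. -/
noncomputable abbrev spec (G : SimpleGraph V) [DecidableRel G.Adj] : Finset ℝ :=
  (G.isHermitian_adjMatrix ℝ).eigenvalueFinset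

/-- The primitive idempotent associated with an eigenvalue. -/
noncomputable abbrev idem (G : SimpleGraph V) [DecidableRel G.Adj] (θ : ℝ) : Matrix V V ℝ :=
  (G.isHermitian_adjMatrix ℝ).eigenprojection θ

theorem isAssociated_iff {θ : ℝ} {E : Matrix V V ℝ} :
    IsAssociated G θ E ↔ θ ∈ spec G ∧ E = idem G θ := by
  constructor
  · rintro ⟨hE, h⟩
    exact (G.isHermitian_adjMatrix ℝ).eigenprojection_eq_of_mem hE.mem hE.ne_zero hE.idem h
  · rintro ⟨hθ, rfl⟩
    refine ⟨⟨Matrix.IsHermitian.eigenprojection_mem _ _,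
      Matrix.IsHermitian.eigenprojection_ne_zero _ hθ,
      Matrix.IsHermitian.eigenprojection_mul_self _ hθ, fun F hF hF2 _ h => ?_⟩,
      Matrix.IsHermitian.mul_eigenprojection _ hθ⟩
    exact Matrix.IsHermitian.eigenprojection_minimal _ hθ hF hF2 h

theorem adjMatrix_pow_dist_ne_zero (hG : IsDistanceRegular G) (u v : V) :
    (G.adjMatrix ℝ ^ G.dist u v) u v ≠ 0 := by
  obtain ⟨p, hp⟩ := hG.connected.exists_walk_length_eq_dist u v
  rw [SimpleGraph.adjMatrix_pow_apply_eq_card_walk, Nat.cast_ne_zero]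
  exact (Fintype.card_pos_iff.mpr ⟨⟨p, hp⟩⟩).ne'

theorem adjMatrix_pow_eq_zero_of_lt_dist {n : ℕ} {u v : V} (h : n < G.dist u v) :
    (G.adjMatrix ℝ ^ n) u v = 0 := by
  rw [SimpleGraph.adjMatrix_pow_apply_eq_card_walk, Nat.cast_eq_zero, Fintype.card_eq_zero_iff]
  refine ⟨fun p => absurd (SimpleGraph.dist_le p.1) (not_le.mpr ?_)⟩
  rwa [show p.1.length = n from p.2]

/-- A distance-regular graph of diameter `d` has `d + 1` distinct eigenvalues. -/
theorem card_spec (hG : IsDistanceRegular G) : (spec G).card = G.diam + 1 := by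
  have := hG.connected.nonempty
  apply le_antisymm
  -- Upper bound: the independent projections lie in the space of distance-dependent matrices, of
  -- dimension at most `d + 1`.
  · let Φ : (Fin (G.diam + 1) → ℝ) →ₗ[ℝ] Matrix V V ℝ :=
      { toFun := fun f => Matrix.of fun u v =>
          f ⟨G.dist u v, Nat.lt_succ_of_le (hG.dist_le_diam u v)⟩
        map_add' := fun f g => rfl
        map_smul' := fun c f => rfl }
    have hmem : ∀ θ : spec G, idem G θ ∈ LinearMap.range Φ := by
      intro θ
      obtain ⟨f, hf⟩ := exists_eq_of_mem_boseMesner hG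
        (Matrix.IsHermitian.eigenprojection_mem (G.isHermitian_adjMatrix ℝ) θ)
      refine ⟨fun i => f i, ?_⟩
      ext u v
      exact (hf u v).symm
    have hli : LinearIndependent ℝ fun θ : spec G => (⟨idem G θ, hmem θ⟩ : LinearMap.range Φ) :=
      LinearIndependent.of_comp (LinearMap.range Φ).subtype
        (G.isHermitian_adjMatrix ℝ).linearIndependent_eigenprojection
    have h1 := hli.fintype_card_le_finrank
    have h2 := LinearMap.finrank_range_le Φ
    simp only [Fintype.card_coe, Module.finrank_fin_fun] at h1 h2
    exact h1.trans h2
  · by_contra! hlt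
    obtain ⟨u, v, huv⟩ := G.exists_dist_eq_diam
    -- With at most `d` eigenvalues, padding by a power of `X` gives a monic annihilating polynomial
    -- of degree exactly `d`. At a pair at distance `d`, only its leading term contributes, and that
    -- entry is nonzero.
    set q : ℝ[X] := X ^ (G.diam - (spec G).card) * ∏ s ∈ spec G, (X - C s) with hq
    have hmon : (∏ s ∈ spec G, (X - C s)).Monic := monic_prod_X_sub_C _ _
    have hqm : q.Monic := (monic_X_pow _).mul hmon
    have hdeg : q.natDegree = G.diam := by
      rw [hq, (monic_X_pow _).natDegree_mul hmon, natDegree_X_pow,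
        natDegree_finsetProd_X_sub_C_eq_card]
      omega
    have h0 : aeval (G.adjMatrix ℝ) q = 0 := by
      rw [(G.isHermitian_adjMatrix ℝ).aeval_eq_zero_iff]
      intro s hs
      rw [hq, eval_mul, eval_prod, Finset.prod_eq_zero hs (by simp), mul_zero]
    have h1 := congrFun (congrFun h0 u) v
    rw [aeval_eq_sum_range, hdeg, Finset.sum_range_succ, ← hdeg, hqm.coeff_natDegree, hdeg,
      Matrix.add_apply, Matrix.sum_apply, Finset.sum_eq_zero] at h1
    · rw [one_smul, zero_add, ← huv] at h1
      exact adjMatrix_pow_dist_ne_zero hG u v h1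
    · intro i hi
      rw [Finset.mem_range] at hi
      rw [Matrix.smul_apply, adjMatrix_pow_eq_zero_of_lt_dist (by omega), smul_zero]

theorem valency_mem_spec (hG : IsDistanceRegular G) : (valency G : ℝ) ∈ spec G := by
  obtain ⟨v⟩ := hG.connected.nonempty
  refine Matrix.IsHermitian.mem_eigenvalueFinset_of_mulVec _ (v := Function.const V 1)
    (fun h => one_ne_zero (congrFun h v)) ?_
  ext u
  rw [SimpleGraph.adjMatrix_mulVec_const_apply, hG.degree_eq]
  simp

/-! ### Entries of the primitive idempotents -/

theorem exists_idem_eq (hG : IsDistanceRegular G) (θ : ℝ) :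
    ∃ f : ℕ → ℝ, ∀ u v, idem G θ u v = f (G.dist u v) :=
  exists_eq_of_mem_boseMesner hG
    (Matrix.IsHermitian.eigenprojection_mem (G.isHermitian_adjMatrix ℝ) θ)

theorem idem_transpose (hG : IsDistanceRegular G) (θ : ℝ) (u v : V) :
    idem G θ u v = idem G θ v u := by
  obtain ⟨f, hf⟩ := exists_idem_eq hG θ
  rw [hf, hf, G.dist_comm]

theorem idem_diag_eq (hG : IsDistanceRegular G) (θ : ℝ) (u v : V) :
    idem G θ u u = idem G θ v v := by
  obtain ⟨f, hf⟩ := exists_idem_eq hG θ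
  rw [hf, hf, SimpleGraph.dist_self, SimpleGraph.dist_self]

/-- A symmetric idempotent is the Gram matrix of its own columns. -/
theorem idem_apply_eq_sum (hG : IsDistanceRegular G) {θ : ℝ} (hθ : θ ∈ spec G) (u v : V) :
    idem G θ u v = ∑ z, idem G θ z u * idem G θ z v := by
  conv_lhs => rw [idem, ← Matrix.IsHermitian.eigenprojection_mul_self _ hθ, Matrix.mul_apply]
  exact Finset.sum_congr rfl fun z _ => by rw [idem_transpose hG θ z u]

theorem idem_diag_ne_zero (hG : IsDistanceRegular G) {θ : ℝ} (hθ : θ ∈ spec G) (u : V) :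
    idem G θ u u ≠ 0 := by
  intro h
  refine Matrix.IsHermitian.eigenprojection_ne_zero (G.isHermitian_adjMatrix ℝ) hθ ?_
  ext z v
  have hv : idem G θ v v = 0 := (idem_diag_eq hG θ v u).trans h
  rw [idem_apply_eq_sum hG hθ,
    Finset.sum_eq_zero_iff_of_nonneg fun z _ => mul_self_nonneg _] at hv
  exact mul_self_eq_zero.mp (hv z (Finset.mem_univ z))

/-- Compare the `(u, u)` entries in `A E = θ E`: all `k` neighbours of `u` contribute the same
entry. -/
theorem valency_mul_idem (hG : IsDistanceRegular G) {θ : ℝ} (hθ : θ ∈ spec G) {u v : V}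
    (huv : G.Adj u v) : valency G * idem G θ u v = θ * idem G θ u u := by
  obtain ⟨f, hf⟩ := exists_idem_eq hG θ
  have h := congrFun (congrFun
    (Matrix.IsHermitian.mul_eigenprojection (G.isHermitian_adjMatrix ℝ) hθ) u) u
  rw [SimpleGraph.adjMatrix_mul_apply, Matrix.smul_apply, smul_eq_mul] at h
  rw [← h, Finset.sum_congr rfl (g := fun _ => idem G θ u v), Finset.sum_const,
    SimpleGraph.card_neighborFinset_eq_degree, hG.degree_eq, nsmul_eq_mul]
  intro z hz
  rw [SimpleGraph.mem_neighborFinset] at hz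
  refine (hf z u).trans ?_
  rw [hf, SimpleGraph.dist_eq_one_iff_adj.mpr hz.symm,
    SimpleGraph.dist_eq_one_iff_adj.mpr huv]

/-- Equality case of Cauchy–Schwarz: the sum of columns `u` and `v` has squared norm `2 E_uu + 2
E_uv = 0`. -/
theorem idem_apply_neg (hG : IsDistanceRegular G) {θ : ℝ} (hθ : θ ∈ spec G) {u v : V}
    (h : idem G θ u v = - idem G θ u u) (z : V) : idem G θ z u = - idem G θ z v := by
  have hv : idem G θ v v = idem G θ u u := idem_diag_eq hG θ v u
  have h0 : ∑ z, (idem G θ z u + idem G θ z v) * (idem G θ z u + idem G θ z v) = 0 := by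
    have : ∀ z, (idem G θ z u + idem G θ z v) * (idem G θ z u + idem G θ z v) =
        idem G θ z u * idem G θ z u + 2 * (idem G θ z u * idem G θ z v) +
          idem G θ z v * idem G θ z v := fun z => by ring
    simp only [this, Finset.sum_add_distrib, ← Finset.mul_sum]
    rw [← idem_apply_eq_sum hG hθ, ← idem_apply_eq_sum hG hθ, ← idem_apply_eq_sum hG hθ, hv, h]
    ring
  rw [Finset.sum_eq_zero_iff_of_nonneg fun z _ => mul_self_nonneg _] at h0
  exact eq_neg_of_add_eq_zero_left (mul_self_eq_zero.mp (h0 z (Finset.mem_univ z)))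

/-- For `θ = -k`, adjacent vertices have opposite columns; going around a triangle changes the sign
three times and forces `E_xx = 0`. -/
theorem ne_neg_valency (hG : IsDistanceRegular G) (ha : a G 1 ≠ 0) {θ : ℝ} (hθ : θ ∈ spec G)
    {x y : V} (hxy : G.Adj x y) (hk : (valency G : ℝ) ≠ 0) : θ ≠ -valency G := by
  intro h
  have key : ∀ {u v : V}, G.Adj u v → ∀ z, idem G θ z u = - idem G θ z v := by
    intro u v huv
    refine idem_apply_neg hG hθ (mul_left_cancel₀ hk ?_)
    rw [valency_mul_idem hG hθ huv, h]
    ring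
  obtain ⟨z, hxz, hyz⟩ := exists_common_neighbor hG ha hxy
  have h1 := key hxy x
  have h2 := key hyz x
  have h3 := key hxz x
  exact idem_diag_ne_zero hG hθ x (by linarith)

theorem linearIndependent_idem_hat (hG : IsDistanceRegular G) (ha : a G 1 ≠ 0) {θ : ℝ}
    (hθ : θ ∈ spec G) (hk : θ ≠ valency G) {x y : V} (hxy : G.Adj x y) :
    LinearIndependent ℝ ![idem G θ *ᵥ hat x, idem G θ *ᵥ hat y] := by
  have hk0 : (valency G : ℝ) ≠ 0 := by
    rw [← hG.degree_eq x, Nat.cast_ne_zero]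
    exact ((G.degree_pos_iff_exists_adj x).mpr ⟨y, hxy⟩).ne'
  have hneg := ne_neg_valency hG ha hθ hxy hk0
  rw [LinearIndependent.pair_iff]
  intro s t hst
  have hx := congrFun hst x
  have hy := congrFun hst y
  simp only [Pi.add_apply, Pi.smul_apply, mulVec_hat, smul_eq_mul, Pi.zero_apply] at hx hy
  have hd := idem_diag_ne_zero hG hθ x
  have hyy : idem G θ y y = idem G θ x x := idem_diag_eq hG θ y x
  have hb := valency_mul_idem hG hθ hxy
  rw [idem_transpose hG θ y x, hyy] at hy
  -- Substituting `k E_xy = θ E_xx` and cancelling `E_xx` leaves a system in `s, t` with determinant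
  -- `k² - θ²`.
  have h1 : s * valency G + t * θ = 0 :=
    mul_right_cancel₀ hd (by linear_combination (valency G : ℝ) * hx - t * hb)
  have h2 : s * θ + t * valency G = 0 :=
    mul_right_cancel₀ hd (by linear_combination (valency G : ℝ) * hy - s * hb)
  have hdet : (θ - valency G) * (θ + valency G) ≠ 0 :=
    mul_ne_zero (sub_ne_zero.mpr hk) fun h => hneg (eq_neg_of_add_eq_zero_left h)
  exact ⟨mul_right_cancel₀ hdet (by linear_combination θ * h2 - (valency G : ℝ) * h1),
    mul_right_cancel₀ hdet (by linear_combination θ * h1 - (valency G : ℝ) * h2)⟩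

/-! ### The trivial eigenvalue and the final count -/

/-- By regularity the `k`-eigenspace is the kernel of the Laplacian, which consists of constants as
the graph is connected. -/
theorem exists_idem_valency_mulVec (hG : IsDistanceRegular G) (v : V → ℝ) :
    ∃ c : ℝ, idem G (valency G) *ᵥ v = c • Function.const V 1 := by
  obtain ⟨o⟩ := hG.connected.nonempty
  set u := idem G (valency G) *ᵥ v with hu
  have hA : G.adjMatrix ℝ *ᵥ u = (valency G : ℝ) • u := by
    rw [hu, mulVec_mulVec, Matrix.IsHermitian.mul_eigenprojection _ (valency_mem_spec hG),
      smul_mulVec]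
  have hL : G.lapMatrix ℝ *ᵥ u = 0 := by
    rw [SimpleGraph.lapMatrix, Matrix.sub_mulVec, hA]
    ext z
    simp [SimpleGraph.degMatrix_mulVec_apply, hG.degree_eq]
  rw [SimpleGraph.lapMatrix_mulVec_eq_zero_iff_forall_reachable] at hL
  refine ⟨u o, ?_⟩
  ext z
  simpa using hL z o (hG.connected.preconnected z o)

theorem finrank_map_H_valency (hG : IsDistanceRegular G) (x y : V) :
    Module.finrank ℝ ((H G x y).map (idem G (valency G)).mulVecLin) = 1 := by
  have h0 : idem G (valency G) *ᵥ hat x ≠ 0 := fun h =>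
    idem_diag_ne_zero hG (valency_mem_spec hG) x
      ((mulVec_hat _ x x).symm.trans (congrFun h x))
  have hx : hat x ∈ H G x y := Submodule.subset_span (by simp)
  refine finrank_eq_one (⟨_, hat x, hx, rfl⟩ : (H G x y).map (idem G (valency G)).mulVecLin)
    (fun h => h0 (congrArg Subtype.val h)) ?_
  rintro ⟨_, v, hv, rfl⟩
  obtain ⟨c, hc⟩ := exists_idem_valency_mulVec hG (hat x)
  obtain ⟨e, he⟩ := exists_idem_valency_mulVec hG v
  have hc0 : c ≠ 0 := by
    rintro rfl
    exact h0 (by rw [hc, zero_smul])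
  refine ⟨e / c, Subtype.ext ?_⟩
  change (e / c) • (idem G (valency G) *ᵥ hat x) = idem G (valency G) *ᵥ v
  rw [hc, he, smul_smul, div_mul_cancel₀ _ hc0]

open Classical in
theorem tightness_eq (x y : V) :
    tightness G x y = (((spec G).erase (valency G : ℝ)).filter fun θ => ¬ LinearIndependent ℝ
      ![idem G θ *ᵥ hat x, idem G θ *ᵥ hat y, idem G θ *ᵥ w G x y]).card := by
  rw [tightness, ← Set.ncard_coe_finset]
  congr 1
  ext θ
  simp only [IsNontrivialEigenvalue, IsTightWrt, isAssociated_iff, Set.mem_ofPred_eq,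
    Finset.coe_filter, Finset.mem_erase]
  constructor
  · rintro ⟨⟨⟨E, hθ, -⟩, hk⟩, F, ⟨-, rfl⟩, h⟩
    exact ⟨⟨hk, hθ⟩, h⟩
  · rintro ⟨⟨hk, hθ⟩, h⟩
    exact ⟨⟨⟨_, hθ, rfl⟩, hk⟩, _, ⟨hθ, rfl⟩, h⟩

end DRG

theorem theorem5p2 {V : Type*} [Fintype V] [DecidableEq V] (G : SimpleGraph V)
    [DecidableRel G.Adj] (hG : DRG.IsDistanceRegular G) (hd : 3 ≤ G.diam) (ha : DRG.a G 1 ≠ 0)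
    (x y : V) (hxy : G.Adj x y) :
    (DRG.tightness G x y : ℤ) =
      3 * (G.diam : ℤ) + 1 -
        (Module.finrank ℝ (DRG.boseMesnerSpan G (DRG.H G x y)) : ℤ) := by
  classical
  have hk := DRG.valency_mem_spec hG
  have hdim : Module.finrank ℝ (DRG.boseMesnerSpan G (DRG.H G x y)) =
      ∑ θ ∈ DRG.spec G, Module.finrank ℝ ((DRG.H G x y).map (DRG.idem G θ).mulVecLin) :=
    (G.isHermitian_adjMatrix ℝ).finrank_span_adjoin_mulVec (DRG.H G x y)
  rw [← Finset.add_sum_erase _ _ hk, DRG.finrank_map_H_valency hG] at hdim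
  have hcard : ((DRG.spec G).erase (DRG.valency G : ℝ)).card = G.diam := by
    rw [Finset.card_erase_of_mem hk, DRG.card_spec hG, Nat.add_sub_cancel]
  -- Each nontrivial eigenvalue contributes `3` to dimension plus tightness; summing over the `d` of
  -- them gives the formula.
  have hsum : ∀ θ ∈ (DRG.spec G).erase (DRG.valency G : ℝ),
      Module.finrank ℝ ((DRG.H G x y).map (DRG.idem G θ).mulVecLin) +
        (if ¬ LinearIndependent ℝ ![DRG.idem G θ *ᵥ DRG.hat x, DRG.idem G θ *ᵥ DRG.hat y,
          DRG.idem G θ *ᵥ DRG.w G x y] then 1 else 0) = 3 := by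
    intro θ hθ
    rw [Finset.mem_erase] at hθ
    rw [DRG.map_H, finrank_span_triple (DRG.linearIndependent_idem_hat hG ha hθ.2 hθ.1 hxy)]
    split_ifs <;> rfl
  have htot := Finset.sum_congr rfl hsum
  rw [Finset.sum_add_distrib, ← Finset.card_filter, ← DRG.tightness_eq, Finset.sum_const, hcard,
    smul_eq_mul] at htot
  omega
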